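/- Let $d\ge 1$, let $\mathbb T^d=(\mathbb R/\mathbb Z)^d$ be the torus with normalized Lebesgue measure $dx$, and put $e_k(x)=e^{2\pi i k\cdot x}$ for $k\in\mathbb Z^d$. All spaces are complex. For an integrable function $f$ on $\mathbb T^d$ let $\hat f(k)=\int_{\mathbb T^d} f(x)\,e_{-k}(x)\,dx$, and for a distribution $g\in D'(\mathbb T^d)$ let $\hat g(k)=g(e_{-k})$. A complex measure $\mu$ on $\mathbb T^d$ is identified with the distribution $\varphi\mapsto\int\varphi\,d\mu$. For a bounded linear operator $T:X\to Y$ and $n\in\mathbb N=\{1,2,\dots\}$ let $$a_n(T)=\inf\{\|T-A\| : A:X\to Y \text{ bounded linear},\ \operatorname{rank}A<n\}$$ be its $n$-th approximation number. Let $w(k)>0$ $(k\in\mathbb Z^d)$ be weights, and consider the following spaces: - $F_d(w)$: the integrable functions $f$ with $\|f\|=\big(\sum_k w(k)^2|\hat f(k)|^2\big)^{1/2}<\infty$; - $\mathcal A(\mathbb T^d)$ (the Wiener algebra): the integrable functions $f$ with $\|f\|=\sum_k|\hat f(k)|<\infty$; - $F_d(1/w)$: the distributions $g\in D'(\mathbb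 T^d)$ with $\|g\|=\big(\sum_k w(k)^{-2}|\hat g(k)|^2\big)^{1/2}<\infty$; - $\mathcal B(\mathbb T^d)$: the distributions $g\in D'(\mathbb T^d)$ with $\|g\|=\sup_k|\hat g(k)|<\infty$; - $\mathcal M(\mathbb T^d)$: the complex measures on $\mathbb T^d$ with the total variation norm. If $\sum_{k\in\mathbb Z^d} w(k)^{-2}<\infty$, then the embeddings (formal identities) $I_d:\mathcal M(\mathbb T^d)\to F_d(1/w)$, $I_d:\mathcal B(\mathbb T^d)\to F_d(1/w)$ and $I_d:F_d(w)\to\mathcal A(\mathbb T^d)$ are well-defined bounded linear operators, and for all $n\in\mathbb N$ $$a_n\big(I_d:\mathcal M(\mathbb T^d)\to F_d(1/w)\big)=a_n\big(I_d:\mathcal B(\mathbb T^d)\to F_d(1/w)\big)=a_n\big(I_d:F_d(w)\to\mathcal A(\mathbb T^d)\big).$$ -/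

import Mathlib

open MeasureTheory UnitAddTorus
open scoped ContDiff

noncomputable section

namespace TorusApprox

/-! ### Approximation numbers -/

/-- The `n`-th approximation number `a_n(T) = inf {‖T - A‖ : rank A < n}` of a bounded linear
operator `T`, where `A` runs over the bounded linear operators of rank less than `n`. -/
def approxNumber {X Y : Type*} [SeminormedAddCommGroup X] [NormedSpace ℂ X]
    [SeminormedAddCommGroup Y] [NormedSpace ℂ Y] (n : ℕ) (T : X →L[ℂ] Y) : ℝ :=
  sInf {r : ℝ | ∃ A : X →L[ℂ] Y,
    LinearMap.rank (A : X →ₗ[ℂ] Y) < (n : Cardinal) ∧ r = ‖T - A‖}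

/-! ### The torus and its normalized Lebesgue measure -/

/-- The `d`-dimensional torus `(ℝ/ℤ)^d`; the character with frequency `k` is
`mFourier k : x ↦ exp (2πi k·x)`. -/
abbrev Torus (d : ℕ) : Type := UnitAddTorus (Fin d)

/-- The normalized Lebesgue measure on the torus. -/
def torusMeasure (d : ℕ) : Measure (Torus d) :=
  Measure.pi fun _ => AddCircle.haarAddCircle

instance (d : ℕ) : IsProbabilityMeasure (torusMeasure d) := by
  unfold torusMeasure; infer_instance

/-- The space `L_1` of integrable complex functions on the torus. -/
abbrev L1 (d : ℕ) : Type := Lp ℂ 1 (torusMeasure d)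

/-- The Fourier coefficient `∫ f(x) exp (-2πi k·x) dx` of an integrable function. -/
def coeffL1 {d : ℕ} (f : L1 d) (k : Fin d → ℤ) : ℂ :=
  ∫ x, mFourier (-k) x * f x ∂torusMeasure d

/-! ### Distributions on the torus -/

/-- The periodic lift of a function on the torus to `ℝ^d`. -/
def lift {d : ℕ} (φ : Torus d → ℂ) : (Fin d → ℝ) → ℂ :=
  fun x => φ fun i => (x i : UnitAddCircle)

/-- The space `D` of smooth complex functions on the torus. -/
def TestFunctions (d : ℕ) : Submodule ℂ (Torus d → ℂ) where
  carrier := {φ | ContDiff ℝ ∞ (lift φ)}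
  zero_mem' := by
    rw [Set.mem_ofPred_eq]
    exact contDiff_const (c := (0 : ℂ))
  add_mem' hf hg := by
    rw [Set.mem_ofPred_eq] at *
    exact hf.add hg
  smul_mem' c _ hf := by
    rw [Set.mem_ofPred_eq] at *
    exact hf.const_smul c

/-- The space `D'` of distributions on the torus: the linear functionals on the smooth functions
that are continuous for the uniform convergence of all derivatives, i.e. bounded by a constant
times the largest supremum norm of the derivatives up to some finite order. -/
def Distributions (d : ℕ) : Submodule ℂ (Module.Dual ℂ (TestFunctions d)) where
  carrier := {u | ∃ (C : ℝ) (N : ℕ), ∀ (φ : TestFunctions d) (M : ℝ),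
    (∀ m ≤ N, ∀ x, ‖iteratedFDeriv ℝ m (lift (φ : Torus d → ℂ)) x‖ ≤ M) → ‖u φ‖ ≤ C * M}
  zero_mem' := ⟨0, 0, fun φ M _ => by simp⟩
  add_mem' := by
    rintro u v ⟨C, N, hu⟩ ⟨C', N', hv⟩
    refine ⟨C + C', max N N', fun φ M h => ?_⟩
    have h1 := hu φ M fun m hm => h m (hm.trans (le_max_left _ _))
    have h2 := hv φ M fun m hm => h m (hm.trans (le_max_right _ _))
    calc ‖(u + v) φ‖ ≤ ‖u φ‖ + ‖v φ‖ := norm_add_le _ _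
      _ ≤ (C + C') * M := by linarith
  smul_mem' := by
    rintro c u ⟨C, N, hu⟩
    refine ⟨‖c‖ * C, N, fun φ M h => ?_⟩
    have h1 := hu φ M h
    calc ‖(c • u) φ‖ = ‖c‖ * ‖u φ‖ := norm_mul c (u φ)
      _ ≤ ‖c‖ * C * M := by
        rw [mul_assoc]; exact mul_le_mul_of_nonneg_left h1 (norm_nonneg c)

theorem lift_mFourier {d : ℕ} (k : Fin d → ℤ) :
    ContDiff ℝ ∞ (lift (mFourier k : Torus d → ℂ)) := by
  have : lift (mFourier k : Torus d → ℂ) =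
      fun x => ∏ i, Complex.exp (2 * Real.pi * Complex.I * (k i) * ((x i : ℝ) : ℂ)) := by
    funext x
    simp [lift, mFourier]
  rw [this]
  refine contDiff_prod fun i _ => ContDiff.cexp (contDiff_const.mul ?_)
  exact Complex.ofRealCLM.contDiff.comp (contDiff_apply ℝ ℝ i)

/-- The character with frequency `k`, as a smooth function. -/
def character {d : ℕ} (k : Fin d → ℤ) : TestFunctions d :=
  ⟨mFourier k, lift_mFourier k⟩

/-- The Fourier coefficient `g (exp (-2πi k·x))` of a distribution `g`. -/
def coeffD {d : ℕ} (g : Distributions d) (k : Fin d → ℤ) : ℂ :=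
  (g : Module.Dual ℂ (TestFunctions d)) (character (-k))

/-! ### Auxiliary facts on Fourier coefficients and on sequence norms -/

theorem integrable_char_mul {d : ℕ} (f : L1 d) (k : Fin d → ℤ) :
    Integrable (fun x => mFourier (-k) x * f x) (torusMeasure d) := by
  refine (L1.integrable_coeFn f).bdd_mul (c := 1)
    (mFourier (-k)).continuous.aestronglyMeasurable (Filter.Eventually.of_forall fun x => ?_)
  exact ((mFourier (-k)).norm_coe_le_norm x).trans mFourier_norm.le

theorem coeffL1_add {d : ℕ} (f g : L1 d) (k : Fin d → ℤ) :
    coeffL1 (f + g) k = coeffL1 f k + coeffL1 g k := by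
  unfold coeffL1
  rw [← integral_add (integrable_char_mul f k) (integrable_char_mul g k)]
  refine integral_congr_ae ?_
  filter_upwards [Lp.coeFn_add f g] with x hx
  rw [hx, Pi.add_apply, mul_add]

theorem coeffL1_smul {d : ℕ} (c : ℂ) (f : L1 d) (k : Fin d → ℤ) :
    coeffL1 (c • f) k = c * coeffL1 f k := by
  unfold coeffL1
  rw [← integral_const_mul]
  refine integral_congr_ae ?_
  filter_upwards [Lp.coeFn_smul c f] with x hx
  rw [hx, Pi.smul_apply, smul_eq_mul]
  ring

theorem coeffD_add {d : ℕ} (f g : Distributions d) (k : Fin d → ℤ) :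
    coeffD (f + g) k = coeffD f k + coeffD g k := rfl

theorem coeffD_smul {d : ℕ} (c : ℂ) (f : Distributions d) (k : Fin d → ℤ) :
    coeffD (c • f) k = c * coeffD f k := rfl

theorem memℓp_two_iff {ι : Type*} {v : ι → ℝ} {a : ι → ℂ} :
    Memℓp (fun k => (v k : ℂ) * a k) 2 ↔ Summable fun k => v k ^ 2 * ‖a k‖ ^ 2 := by
  rw [memℓp_gen_iff (by norm_num)]
  simp [mul_pow]

theorem weighted_add {ι : Type*} {v : ι → ℝ} {a b : ι → ℂ}
    (ha : Summable fun k => v k ^ 2 * ‖a k‖ ^ 2) (hb : Summable fun k => v k ^ 2 * ‖b k‖ ^ 2) :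
    (Summable fun k => v k ^ 2 * ‖a k + b k‖ ^ 2) ∧
      √(∑' k, v k ^ 2 * ‖a k + b k‖ ^ 2) ≤
        √(∑' k, v k ^ 2 * ‖a k‖ ^ 2) + √(∑' k, v k ^ 2 * ‖b k‖ ^ 2) := by
  have key : ∀ {c : ι → ℂ} (hc : Summable fun k => v k ^ 2 * ‖c k‖ ^ 2),
      ‖(⟨fun k => (v k : ℂ) * c k, memℓp_two_iff.2 hc⟩ : lp (fun _ : ι => ℂ) 2)‖ =
        √(∑' k, v k ^ 2 * ‖c k‖ ^ 2) := by
    intro c hc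
    rw [lp.norm_eq_tsum_rpow (by norm_num), Real.sqrt_eq_rpow]
    simp [mul_pow]
  have hab : Memℓp (fun k => (v k : ℂ) * (a k + b k)) 2 := by
    have h := (memℓp_two_iff.2 ha).add (memℓp_two_iff.2 hb)
    convert h using 1
    funext k
    exact mul_add _ _ _
  have hs := memℓp_two_iff.1 hab
  refine ⟨hs, ?_⟩
  rw [← key ha, ← key hb, ← key hs]
  refine le_trans (le_of_eq ?_) (norm_add_le _ _)
  congr 1
  ext k
  exact mul_add _ _ _

theorem weighted_smul {ι : Type*} {v : ι → ℝ} {a : ι → ℂ} (c : ℂ) :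
    (fun k => v k ^ 2 * ‖c * a k‖ ^ 2) = fun k => ‖c‖ ^ 2 * (v k ^ 2 * ‖a k‖ ^ 2) := by
  funext k
  rw [norm_mul]
  ring

theorem sqrt_weighted_smul {ι : Type*} {v : ι → ℝ} {a : ι → ℂ} (c : ℂ) :
    √(∑' k, v k ^ 2 * ‖c * a k‖ ^ 2) = ‖c‖ * √(∑' k, v k ^ 2 * ‖a k‖ ^ 2) := by
  rw [weighted_smul, tsum_mul_left, Real.sqrt_mul (by positivity), Real.sqrt_sq (norm_nonneg c)]

/-! ### The Hilbert space `F_d(w)` of integrable functions -/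

/-- The integrable functions `f` with `∑ w(k)² |f̂(k)|² < ∞`. -/
def FdSubmodule {d : ℕ} (w : (Fin d → ℤ) → ℝ) : Submodule ℂ (L1 d) where
  carrier := {f | Summable fun k => w k ^ 2 * ‖coeffL1 f k‖ ^ 2}
  zero_mem' := by
    have h : ∀ k, coeffL1 (0 : L1 d) k = 0 := fun k => by
      simpa using coeffL1_smul 0 (0 : L1 d) k
    simp [h]
  add_mem' hf hg := by
    simp only [Set.mem_ofPred_eq, coeffL1_add]
    exact (weighted_add hf hg).1
  smul_mem' c f hf := by
    simp only [Set.mem_ofPred_eq, coeffL1_smul, weighted_smul]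
    exact Summable.mul_left _ hf

/-- The space `F_d(w)`, with the norm `(∑ w(k)² |f̂(k)|²)^{1/2}`. -/
def Fd {d : ℕ} (w : (Fin d → ℤ) → ℝ) : Type := FdSubmodule w

namespace Fd
variable {d : ℕ} {w : (Fin d → ℤ) → ℝ}

instance : AddCommGroup (Fd w) := inferInstanceAs (AddCommGroup (FdSubmodule w))
instance : Module ℂ (Fd w) := inferInstanceAs (Module ℂ (FdSubmodule w))

/-- The underlying integrable function. -/
def toL1 (f : Fd w) : L1 d := Subtype.val (p := fun x => x ∈ FdSubmodule w) f

instance : Norm (Fd w) := ⟨fun f => √(∑' k, w k ^ 2 * ‖coeffL1 f.toL1 k‖ ^ 2)⟩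

theorem core : SeminormedSpace.Core ℂ (Fd w) where
  norm_nonneg _ := Real.sqrt_nonneg _
  norm_smul c f := by
    change √(∑' k, w k ^ 2 * ‖coeffL1 (c • f.toL1) k‖ ^ 2) = _
    simp only [coeffL1_smul]
    exact sqrt_weighted_smul c
  norm_triangle f g := by
    change √(∑' k, w k ^ 2 * ‖coeffL1 (f.toL1 + g.toL1) k‖ ^ 2) ≤ _
    simp only [coeffL1_add]
    exact (weighted_add f.2 g.2).2

instance : SeminormedAddCommGroup (Fd w) := SeminormedAddCommGroup.ofCore core
instance : NormedSpace ℂ (Fd w) where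
  norm_smul_le c f := (core.norm_smul c f).le

end Fd

/-! ### The Wiener algebra -/

/-- The integrable functions with absolutely convergent Fourier series. -/
def WienerSubmodule (d : ℕ) : Submodule ℂ (L1 d) where
  carrier := {f | Summable fun k => ‖coeffL1 f k‖}
  zero_mem' := by
    have h : ∀ k, coeffL1 (0 : L1 d) k = 0 := fun k => by
      simpa using coeffL1_smul 0 (0 : L1 d) k
    simp [h]
  add_mem' {f g} hf hg := by
    simp only [Set.mem_ofPred_eq, coeffL1_add]
    exact (Summable.add hf hg).of_nonneg_of_le (fun _ => norm_nonneg _)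
      fun k => norm_add_le (coeffL1 f k) (coeffL1 g k)
  smul_mem' c f hf := by
    simp only [Set.mem_ofPred_eq, coeffL1_smul, norm_mul]
    exact Summable.mul_left _ hf

/-- The Wiener algebra, with the norm `∑ |f̂(k)|`. -/
def Wiener (d : ℕ) : Type := WienerSubmodule d

namespace Wiener
variable {d : ℕ}

instance : AddCommGroup (Wiener d) := inferInstanceAs (AddCommGroup (WienerSubmodule d))
instance : Module ℂ (Wiener d) := inferInstanceAs (Module ℂ (WienerSubmodule d))

/-- The underlying integrable function. -/
def toL1 (f : Wiener d) : L1 d := Subtype.val (p := fun x => x ∈ WienerSubmodule d) f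

instance : Norm (Wiener d) := ⟨fun f => ∑' k, ‖coeffL1 f.toL1 k‖⟩

theorem core : SeminormedSpace.Core ℂ (Wiener d) where
  norm_nonneg f := tsum_nonneg fun k => norm_nonneg (coeffL1 f.toL1 k)
  norm_smul c f := by
    change ∑' k, ‖coeffL1 (c • f.toL1) k‖ = _
    simp only [coeffL1_smul, norm_mul]
    exact tsum_mul_left
  norm_triangle f g := by
    have hf : Summable fun k => ‖coeffL1 f.toL1 k‖ := f.2
    have hg : Summable fun k => ‖coeffL1 g.toL1 k‖ := g.2
    have hfg : Summable fun k => ‖coeffL1 (f.toL1 + g.toL1) k‖ := (f + g).2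
    change ∑' k, ‖coeffL1 (f.toL1 + g.toL1) k‖ ≤
      ∑' k, ‖coeffL1 f.toL1 k‖ + ∑' k, ‖coeffL1 g.toL1 k‖
    rw [← hf.tsum_add hg]
    refine hfg.tsum_le_tsum (fun k => ?_) (hf.add hg)
    rw [coeffL1_add]
    exact norm_add_le _ _

instance : SeminormedAddCommGroup (Wiener d) := SeminormedAddCommGroup.ofCore core
instance : NormedSpace ℂ (Wiener d) where
  norm_smul_le c f := (core.norm_smul c f).le

end Wiener

/-! ### The space `F_d(v)` of distributions -/

/-- The distributions `g` with `∑ v(k)² |ĝ(k)|² < ∞`. -/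
def DFdSubmodule {d : ℕ} (v : (Fin d → ℤ) → ℝ) : Submodule ℂ (Distributions d) where
  carrier := {g | Summable fun k => v k ^ 2 * ‖coeffD g k‖ ^ 2}
  zero_mem' := by
    have h : ∀ k, coeffD (0 : Distributions d) k = 0 := fun k => rfl
    simp [h]
  add_mem' hf hg := by
    simp only [Set.mem_ofPred_eq, coeffD_add]
    exact (weighted_add hf hg).1
  smul_mem' c f hf := by
    simp only [Set.mem_ofPred_eq, coeffD_smul, weighted_smul]
    exact Summable.mul_left _ hf

/-- The space `F_d(v)` as a space of distributions, with the norm `(∑ v(k)² |ĝ(k)|²)^{1/2}`. -/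
def DFd {d : ℕ} (v : (Fin d → ℤ) → ℝ) : Type := DFdSubmodule v

namespace DFd
variable {d : ℕ} {v : (Fin d → ℤ) → ℝ}

instance : AddCommGroup (DFd v) := inferInstanceAs (AddCommGroup (DFdSubmodule v))
instance : Module ℂ (DFd v) := inferInstanceAs (Module ℂ (DFdSubmodule v))

/-- The underlying distribution. -/
def toD (g : DFd v) : Distributions d := Subtype.val (p := fun x => x ∈ DFdSubmodule v) g

instance : Norm (DFd v) := ⟨fun g => √(∑' k, v k ^ 2 * ‖coeffD g.toD k‖ ^ 2)⟩

theorem core : SeminormedSpace.Core ℂ (DFd v) where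
  norm_nonneg _ := Real.sqrt_nonneg _
  norm_smul c f := by
    change √(∑' k, v k ^ 2 * ‖coeffD (c • f.toD) k‖ ^ 2) = _
    simp only [coeffD_smul]
    exact sqrt_weighted_smul c
  norm_triangle f g := by
    change √(∑' k, v k ^ 2 * ‖coeffD (f.toD + g.toD) k‖ ^ 2) ≤ _
    simp only [coeffD_add]
    exact (weighted_add f.2 g.2).2

instance : SeminormedAddCommGroup (DFd v) := SeminormedAddCommGroup.ofCore core
instance : NormedSpace ℂ (DFd v) where
  norm_smul_le c f := (core.norm_smul c f).le

end DFd

/-! ### The space of distributions with bounded Fourier coefficients -/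

/-- The distributions with bounded Fourier coefficients. -/
def BSubmodule (d : ℕ) : Submodule ℂ (Distributions d) where
  carrier := {g | BddAbove (Set.range fun k => ‖coeffD g k‖)}
  zero_mem' := ⟨0, by rintro _ ⟨k, rfl⟩; exact norm_zero.le⟩
  add_mem' := by
    rintro f g ⟨M, hM⟩ ⟨M', hM'⟩
    refine ⟨M + M', ?_⟩
    rintro _ ⟨k, rfl⟩
    exact (norm_add_le (coeffD f k) (coeffD g k)).trans
      (add_le_add (hM ⟨k, rfl⟩) (hM' ⟨k, rfl⟩))
  smul_mem' := by
    rintro c f ⟨M, hM⟩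
    refine ⟨‖c‖ * M, ?_⟩
    rintro _ ⟨k, rfl⟩
    simp only [coeffD_smul, norm_mul]
    exact mul_le_mul_of_nonneg_left (hM ⟨k, rfl⟩) (norm_nonneg c)

/-- The space of distributions with bounded Fourier coefficients, with the norm `sup |ĝ(k)|`. -/
def BSpace (d : ℕ) : Type := BSubmodule d

namespace BSpace
variable {d : ℕ}

instance : AddCommGroup (BSpace d) := inferInstanceAs (AddCommGroup (BSubmodule d))
instance : Module ℂ (BSpace d) := inferInstanceAs (Module ℂ (BSubmodule d))

/-- The underlying distribution. -/
def toD (g : BSpace d) : Distributions d := Subtype.val (p := fun x => x ∈ BSubmodule d) g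

instance : Norm (BSpace d) := ⟨fun g => ⨆ k, ‖coeffD g.toD k‖⟩

theorem core : SeminormedSpace.Core ℂ (BSpace d) where
  norm_nonneg g := Real.iSup_nonneg fun k => norm_nonneg (coeffD g.toD k)
  norm_smul c g := by
    change ⨆ k, ‖coeffD (c • g.toD) k‖ = ‖c‖ * ⨆ k, ‖coeffD g.toD k‖
    simp only [coeffD_smul, norm_mul]
    exact (Real.mul_iSup_of_nonneg (norm_nonneg c) _).symm
  norm_triangle f g := by
    have hf : BddAbove (Set.range fun k => ‖coeffD f.toD k‖) := f.2
    have hg : BddAbove (Set.range fun k => ‖coeffD g.toD k‖) := g.2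
    exact ciSup_le fun k => (norm_add_le (coeffD f.toD k) (coeffD g.toD k)).trans
      (add_le_add (le_ciSup hf k) (le_ciSup hg k))

instance : SeminormedAddCommGroup (BSpace d) := SeminormedAddCommGroup.ofCore core
instance : NormedSpace ℂ (BSpace d) where
  norm_smul_le c f := (core.norm_smul c f).le

end BSpace

/-! ### The space of complex measures -/

/-- The space of complex measures on the torus, with the total variation norm. -/
def MSpace (d : ℕ) : Type := ComplexMeasure (Torus d)

namespace MSpace
variable {d : ℕ}

instance : AddCommGroup (MSpace d) := inferInstanceAs (AddCommGroup (ComplexMeasure (Torus d)))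
instance : Module ℂ (MSpace d) := inferInstanceAs (Module ℂ (ComplexMeasure (Torus d)))

/-- The underlying complex measure. -/
def toMeasure (μ : MSpace d) : ComplexMeasure (Torus d) := μ

theorem variation_ne_top (μ : MSpace d) : μ.toMeasure.variation Set.univ ≠ ⊤ := by
  set r := ComplexMeasure.re μ.toMeasure
  set s := ComplexMeasure.im μ.toMeasure
  have h : μ.toMeasure.variation ≤ r.totalVariation + s.totalVariation := by
    refine VectorMeasure.variation_le_of_forall_enorm_le fun E _ => ?_
    have h1 := SignedMeasure.enorm_le_totalVariation r E
    have h2 := SignedMeasure.enorm_le_totalVariation s E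
    have h3 : μ.toMeasure E = ((r E : ℝ) : ℂ) + ((s E : ℝ) : ℂ) * Complex.I :=
      (Complex.re_add_im _).symm
    rw [h3, Measure.add_apply]
    refine (enorm_add_le _ _).trans (add_le_add ?_ ?_)
    · simpa [enorm_eq_nnnorm] using h1
    · simpa [enorm_eq_nnnorm] using h2
  exact ne_top_of_le_ne_top (measure_ne_top _ _) (h Set.univ)

instance : Norm (MSpace d) := ⟨fun μ => (μ.toMeasure.variation Set.univ).toReal⟩

theorem core : SeminormedSpace.Core ℂ (MSpace d) where
  norm_nonneg _ := ENNReal.toReal_nonneg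
  norm_smul c μ := by
    change ((c • μ.toMeasure).variation Set.univ).toReal = _
    rw [VectorMeasure.variation_smul]
    rw [Measure.smul_apply, ENNReal.smul_def, smul_eq_mul, ENNReal.toReal_mul]
    rfl
  norm_triangle μ ν := by
    change ((μ.toMeasure + ν.toMeasure).variation Set.univ).toReal ≤
      (μ.toMeasure.variation Set.univ).toReal + (ν.toMeasure.variation Set.univ).toReal
    rw [← ENNReal.toReal_add μ.variation_ne_top ν.variation_ne_top]
    exact ENNReal.toReal_mono
      (ENNReal.add_ne_top.2 ⟨μ.variation_ne_top, ν.variation_ne_top⟩)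
      (VectorMeasure.variation_add_le Set.univ)

instance : SeminormedAddCommGroup (MSpace d) := SeminormedAddCommGroup.ofCore core
instance : NormedSpace ℂ (MSpace d) where
  norm_smul_le c f := (core.norm_smul c f).le

end MSpace

end TorusApprox

end

/-! All three approximation numbers equal the same explicit quantity: the infimum, over sets `t` of
fewer than `n` frequencies, of the `ℓ_2` norm of `σ = 1/w` off `t`. The infimum is never named; each
comparison passes through it.

Upper bound: cutting the Fourier series down to `t` is an operator of rank less than `n`, and
Cauchy–Schwarz (for `F_d(w) → 𝒜`) or `|ĝ(k)| ≤ ‖g‖` (for `ℬ → F_d(1/w)`) bounds the error by the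
tail. The bound for `ℳ` follows from that for `ℬ`, since `ℳ → ℬ` has norm at most one.

Lower bound: if `rank A < n`, there is a subspace `V` of dimension less than `n` such that, for
every `x`, the vector `(σ_k e_{-k}(x))_k` over a finite set of frequencies lies within `‖T - A‖` of
`V`. For `ℳ` these vectors are weighted coefficients of Dirac masses; for `𝒜` the character vectors
act as functionals of norm at most one, and `V` is the range of the adjoint of a compression of `A`.
Averaging the squared distances over a grid on which the characters are orthogonal gives `∑ σ_k² (1
- p_k)`, with `p_k` the diagonal of the projection onto `V`. Since `0 ≤ p_k ≤ 1` and `∑ p_k = dim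
V`, this is at least a tail of `∑ σ_k²` (`exists_sum_compl_sq_le`, `exists_tsum_tail_le`). -/

open MeasureTheory UnitAddTorus
open scoped ContDiff

noncomputable section

namespace TorusApprox

/-! ### Extremal subsets of finite families -/

/-- The `m` largest values of a nonnegative function on a finite set are separated from the others
by a threshold. -/
theorem exists_threshold {κ : Type*} [Fintype κ] [DecidableEq κ] (a : κ → ℝ) (ha : ∀ k, 0 ≤ a k)
    (m : ℕ) :
    ∃ (s : Finset κ) (t : ℝ), s.card ≤ m ∧ 0 ≤ t ∧ (∀ k ∈ s, t ≤ a k) ∧ (∀ k ∉ s, a k ≤ t) ∧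
      (t = 0 ∨ s.card = m) := by
  induction m with
  | zero =>
    -- With nothing selected, any nonnegative upper bound of `a` is a threshold; the sum is one even
    -- when `κ` is empty.
    refine ⟨∅, ∑ k, a k, le_rfl, Finset.sum_nonneg fun k _ => ha k, by simp, fun k _ => ?_,
      Or.inr rfl⟩
    exact Finset.single_le_sum (fun k _ => ha k) (Finset.mem_univ k)
  | succ m ih =>
    obtain ⟨s, t, hs, -, hts, hst, hor⟩ := ih
    by_cases hne : sᶜ.Nonempty
    · obtain ⟨j, hj, hmax⟩ := sᶜ.exists_max_image a hne
      rw [Finset.mem_compl] at hj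
      have hcard : (insert j s).card = s.card + 1 := Finset.card_insert_of_notMem hj
      refine ⟨insert j s, a j, by omega, ha j, fun k hk => ?_, fun k hk => ?_, ?_⟩
      · rcases Finset.mem_insert.1 hk with rfl | hk
        · exact le_rfl
        · exact (hst j hj).trans (hts k hk)
      · exact hmax k (Finset.mem_compl.2 fun h => hk (Finset.mem_insert_of_mem h))
      · rcases hor with h | h
        · exact Or.inl (le_antisymm (h ▸ hst j hj) (ha j))
        · exact Or.inr (by omega)
    · have hu : ∀ k, k ∈ s := fun k => by
        by_contra h
        exact hne ⟨k, Finset.mem_compl.2 h⟩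
      -- All points are used up and there may be fewer than `m + 1` of them; the alternative `t = 0`
      -- exists for this case.
      exact ⟨s, 0, hs.trans (Nat.le_succ m), le_rfl, fun k _ => ha k,
        fun k hk => absurd (hu k) hk, Or.inl rfl⟩

/-- Bathtub principle: a linear form over `0 ≤ p ≤ 1`, `∑ p ≤ m` is largest at the indicator of the
`m` largest coefficients. With the threshold `t`, `(a_k - t)(p_k - 1_s(k)) ≤ 0` at every point, and
the leftover `t (∑ p - |s|)` is nonpositive. -/
theorem exists_card_le_sum_mul_le {κ : Type*} [Fintype κ] [DecidableEq κ] (a p : κ → ℝ)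
    (ha : ∀ k, 0 ≤ a k) (hp : ∀ k, 0 ≤ p k) (hp1 : ∀ k, p k ≤ 1) (m : ℕ) (hpm : ∑ k, p k ≤ m) :
    ∃ s : Finset κ, s.card ≤ m ∧ ∑ k, a k * p k ≤ ∑ k ∈ s, a k := by
  obtain ⟨s, t, hs, ht, hts, hst, hor⟩ := exists_threshold a ha m
  refine ⟨s, hs, ?_⟩
  have h1 : ∀ k, a k * p k - (if k ∈ s then a k else 0) ≤ t * p k - (if k ∈ s then t else 0) := by
    intro k
    split_ifs with hk
    · nlinarith [hts k hk, hp1 k]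
    · simpa using mul_le_mul_of_nonneg_right (hst k hk) (hp k)
  have h2 := Finset.sum_le_sum fun k (_ : k ∈ Finset.univ) => h1 k
  simp only [Finset.sum_sub_distrib, Finset.sum_ite_mem, Finset.univ_inter, ← Finset.mul_sum,
    Finset.sum_const, nsmul_eq_mul] at h2
  have h3 : t * ∑ k, p k - s.card * t ≤ 0 := by
    rcases hor with rfl | h
    · simp
    · rw [h]; nlinarith
  linarith

/-! ### Approximation of diagonal images of an orthogonal system of vectors -/

section Orthogonal

variable {κ X : Type*} [Fintype κ] [Fintype X]

/-- Expanding the square, the cross terms vanish on summing over `x`, because the columns of `ε` are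
orthogonal of squared length `N`. -/
theorem sum_norm_sq_of_orthogonal [DecidableEq κ] {ε : X → κ → ℂ} {N : ℝ}
    (hε : ∀ k l, ∑ x, ε x k * star (ε x l) = if k = l then (N : ℂ) else 0) (a : κ → ℂ) :
    ∑ x, ‖∑ k, a k * ε x k‖ ^ 2 = N * ∑ k, ‖a k‖ ^ 2 := by
  apply Complex.ofReal_injective
  push_cast
  have h : ∀ z : ℂ, (‖z‖ : ℂ) ^ 2 = z * star z := fun z => by
    rw [Complex.star_def, Complex.mul_conj']
  simp only [h, star_sum, star_mul', Finset.sum_mul_sum]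
  rw [Finset.sum_comm, Finset.mul_sum]
  refine Finset.sum_congr rfl fun k _ => ?_
  rw [Finset.sum_comm]
  have : ∀ l, ∑ x, a k * ε x k * (star (a l) * star (ε x l)) =
      a k * star (a l) * if k = l then (N : ℂ) else 0 := fun l => by
    rw [← hε k l, Finset.mul_sum]
    exact Finset.sum_congr rfl fun x _ => by ring
  simp only [this, mul_ite, mul_zero, Finset.sum_ite_eq, Finset.mem_univ, if_true]
  ring

/-- By Parseval in `V` and Pythagoras, the left side is the squared norm of the component of `z`
orthogonal to `V`, which is unchanged by subtracting `b ∈ V`. -/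
theorem norm_sq_sub_sum_inner_le {m : Type*} [Fintype m] {V : Submodule ℂ (EuclideanSpace ℂ κ)}
    (u : OrthonormalBasis m ℂ V) (z : EuclideanSpace ℂ κ) {b : EuclideanSpace ℂ κ} (hb : b ∈ V) :
    ‖z‖ ^ 2 - ∑ j, ‖inner ℂ (u j : EuclideanSpace ℂ κ) z‖ ^ 2 ≤ ‖z - b‖ ^ 2 := by
  have h1 : ∑ j, ‖inner ℂ (u j : EuclideanSpace ℂ κ) z‖ ^ 2 =
      ‖V.orthogonalProjectionOnto z‖ ^ 2 := by
    rw [← u.sum_sq_norm_inner_right (V.orthogonalProjectionOnto z)]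
    refine Finset.sum_congr rfl fun j _ => ?_
    rw [Submodule.inner_orthogonalProjectionOnto_eq_of_mem_left]
  have h2 := Submodule.norm_sq_eq_add_norm_sq_projection z V
  have h3 : V.orthogonalProjectionOnto (z - b) = V.orthogonalProjectionOnto z - ⟨b, hb⟩ := by
    rw [map_sub]
    congr 1
    exact Submodule.orthogonalProjectionOnto_mem_subspace_eq_self (K := V) ⟨b, hb⟩
  have h4 := Submodule.norm_sq_eq_add_norm_sq_projection (z - b) V
  have h5 : Vᗮ.orthogonalProjectionOnto (z - b) = Vᗮ.orthogonalProjectionOnto z := by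
    rw [map_sub, Submodule.orthogonalProjectionOnto_orthogonal_apply_eq_zero hb, sub_zero]
  rw [h5] at h4
  rw [h1, h2, h4]
  simp only [Submodule.coe_norm]
  nlinarith [sq_nonneg ‖V.orthogonalProjectionOnto (z - b)‖]

/-- If the vectors `(σ_k ε_{x,k})_k` are all within `r` of a subspace `V`, where the `ε_x` form an
orthogonal system of rows, then `σ` is within `r` of a sequence supported on `dim V` points. -/
theorem exists_sum_compl_sq_le [DecidableEq κ] [Nonempty X] {ε : X → κ → ℂ}
    (hε : ∀ k l, ∑ x, ε x k * star (ε x l) = if k = l then ((Fintype.card X : ℝ) : ℂ) else 0)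
    (σ : κ → ℝ) (V : Submodule ℂ (EuclideanSpace ℂ κ)) (r : ℝ)
    (hr : ∀ x, ∃ b ∈ V, ‖WithLp.toLp 2 (fun k => (σ k : ℂ) * ε x k) - b‖ ≤ r) :
    ∃ s : Finset κ, s.card ≤ Module.finrank ℂ V ∧ ∑ k ∈ sᶜ, σ k ^ 2 ≤ r ^ 2 := by
  set N : ℝ := ((Fintype.card X : ℕ) : ℝ) with hN
  have hN0 : 0 < N := by rw [hN]; exact_mod_cast Fintype.card_pos
  set u := stdOrthonormalBasis ℂ V
  -- The diagonal of the orthogonal projection onto `V`: at most one by Bessel, with trace `dim V`.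
  set p : κ → ℝ := fun k => ∑ j, ‖(u j : EuclideanSpace ℂ κ) k‖ ^ 2 with hpdef
  have hon : Orthonormal ℂ fun j => (u j : EuclideanSpace ℂ κ) :=
    u.orthonormal.comp_linearIsometry V.subtypeₗᵢ
  have hp1 : ∀ k, p k ≤ 1 := fun k => by
    have h := hon.sum_inner_products_le (s := Finset.univ) (EuclideanSpace.single k (1 : ℂ))
    simpa [EuclideanSpace.inner_single_right] using h
  have hpm : ∑ k, p k ≤ Module.finrank ℂ V := by
    rw [hpdef, Finset.sum_comm]
    have : ∀ j, ∑ k, ‖(u j : EuclideanSpace ℂ κ) k‖ ^ 2 = 1 := fun j => by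
      rw [← EuclideanSpace.norm_sq_eq, hon.1 j, one_pow]
    simp [this]
  obtain ⟨s, hs, hsum⟩ := exists_card_le_sum_mul_le (fun k => σ k ^ 2) p (fun k => sq_nonneg _)
    (fun k => Finset.sum_nonneg fun j _ => sq_nonneg _) hp1 _ hpm
  refine ⟨s, hs, ?_⟩
  have hx : ∀ x, ∑ k, ‖(σ k : ℂ) * ε x k‖ ^ 2 -
      ∑ j, ‖∑ k, (star ((u j : EuclideanSpace ℂ κ) k) * σ k) * ε x k‖ ^ 2 ≤ r ^ 2 := fun x => by
    obtain ⟨b, hb, hbr⟩ := hr x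
    have h := norm_sq_sub_sum_inner_le u (WithLp.toLp 2 fun k => (σ k : ℂ) * ε x k) hb
    rw [EuclideanSpace.norm_sq_eq] at h
    have h' : ∀ j, inner ℂ (u j : EuclideanSpace ℂ κ) (WithLp.toLp 2 fun k => (σ k : ℂ) * ε x k) =
        ∑ k, (star ((u j : EuclideanSpace ℂ κ) k) * σ k) * ε x k := fun j => by
      rw [PiLp.inner_apply]
      refine Finset.sum_congr rfl fun k _ => ?_
      simp only [RCLike.inner_apply, Complex.star_def]
      ring
    simp only [h'] at h
    exact h.trans (pow_le_pow_left₀ (norm_nonneg _) hbr 2)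
  -- Summing over `x` removes `ε` from both terms and leaves `N (∑ σ_k² - ∑ σ_k² p_k) ≤ N r²`.
  have hxs := Finset.sum_le_sum fun x (_ : x ∈ Finset.univ) => hx x
  rw [Finset.sum_sub_distrib, Finset.sum_comm, Finset.sum_comm (γ := X)] at hxs
  simp only [sum_norm_sq_of_orthogonal hε] at hxs
  have hone : ∀ k, ∑ x, ‖(σ k : ℂ) * ε x k‖ ^ 2 = N * σ k ^ 2 := fun k => by
    have h := sum_norm_sq_of_orthogonal hε (Pi.single k (σ k : ℂ))
    simpa [Pi.single_apply, apply_ite, Finset.sum_ite_eq, ite_mul, ite_pow] using h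
  simp only [hone, ← Finset.mul_sum, Finset.sum_const, Finset.card_univ, nsmul_eq_mul, ← hN,
    ← mul_sub] at hxs
  have hfin := le_of_mul_le_mul_left hxs hN0
  have h6 : ∑ j, ∑ k, ‖star ((u j : EuclideanSpace ℂ κ) k) * (σ k : ℂ)‖ ^ 2 =
      ∑ k, σ k ^ 2 * p k := by
    rw [Finset.sum_comm]
    refine Finset.sum_congr rfl fun k _ => ?_
    rw [hpdef, Finset.mul_sum]
    refine Finset.sum_congr rfl fun j _ => ?_
    rw [norm_mul, norm_star, mul_pow, Complex.norm_real, Real.norm_eq_abs, sq_abs, mul_comm]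
  rw [h6] at hfin
  have h7 := Finset.sum_add_sum_compl s fun k => σ k ^ 2
  linarith

end Orthogonal

/-! ### Discrete orthogonality of the characters -/

/-- The points of the grid of mesh `1 / N` on the torus. -/
def gridPoint {d N : ℕ} (x : Fin d → Fin N) : Torus d :=
  fun i => (((x i : ℕ) / N : ℝ) : UnitAddCircle)

theorem mFourier_mul_star {d : ℕ} (k l : Fin d → ℤ) (x : Torus d) :
    mFourier k x * star (mFourier l x) = mFourier (k - l) x := by
  rw [sub_eq_add_neg, mFourier_add, mFourier_neg, Complex.star_def]

/-- A geometric sum of powers of `ζ = exp (2πi m/N)`: `ζ^N = 1`, while `ζ ≠ 1` because `0 < |m| < N`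
prevents `N` from dividing `m`. -/
theorem sum_fourier_grid_eq_zero {N : ℕ} {m : ℤ} (hm : m ≠ 0) (hmN : |m| < N) :
    ∑ j : Fin N, (fourier m (((j : ℕ) / N : ℝ) : UnitAddCircle) : ℂ) = 0 := by
  have hN : (N : ℂ) ≠ 0 := by
    have : (0 : ℤ) < N := (abs_nonneg m).trans_lt hmN
    exact_mod_cast this.ne'
  set ζ : ℂ := Complex.exp (2 * Real.pi * Complex.I * (m / N)) with hζ
  have h1 : ∀ j : ℕ, (fourier m ((j / N : ℝ) : UnitAddCircle) : ℂ) = ζ ^ j := fun j => by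
    rw [fourier_coe_apply, hζ, ← Complex.exp_nat_mul]
    congr 1
    push_cast
    field_simp
  simp only [h1]
  rw [Fin.sum_univ_eq_sum_range (fun j => ζ ^ j)]
  have hζN : ζ ^ N = 1 := by
    rw [hζ, ← Complex.exp_nat_mul, Complex.exp_eq_one_iff]
    exact ⟨m, by field_simp⟩
  have hζ1 : ζ ≠ 1 := by
    intro h
    rw [hζ, Complex.exp_eq_one_iff] at h
    obtain ⟨q, hq⟩ := h
    have hpi : (2 * Real.pi * Complex.I : ℂ) ≠ 0 := Complex.two_pi_I_ne_zero
    rw [mul_comm (q : ℂ)] at hq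
    have hq' := mul_left_cancel₀ hpi hq
    rw [div_eq_iff hN] at hq'
    have hq2 : m = q * N := by exact_mod_cast hq'
    exact hm (Int.eq_zero_of_abs_lt_dvd ⟨q, by rw [hq2, mul_comm]⟩ hmN)
  rw [geom_sum_eq hζ1, hζN, sub_self, zero_div]

/-- The sum over the product grid factors over the coordinates, and a coordinate with `m i ≠ 0`
contributes a zero factor. -/
theorem sum_mFourier_gridPoint {d N : ℕ} {m : Fin d → ℤ} (hm : ∀ i, |m i| < N) :
    ∑ x : Fin d → Fin N, mFourier m (gridPoint x) =
      if m = 0 then ((Fintype.card (Fin d → Fin N) : ℝ) : ℂ) else 0 := by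
  split_ifs with h
  · simp [h, mFourier_zero]
  · obtain ⟨i, hi⟩ := Function.ne_iff.1 h
    simp only [mFourier, ContinuousMap.coe_mk, gridPoint]
    have := Finset.prod_univ_sum (fun _ : Fin d => (Finset.univ : Finset (Fin N)))
      fun i j => (fourier (m i) (((j : ℕ) / N : ℝ) : UnitAddCircle) : ℂ)
    rw [Fintype.piFinset_univ] at this
    rw [← this]
    exact Finset.prod_eq_zero (Finset.mem_univ i) (sum_fourier_grid_eq_zero hi (hm i))

theorem exists_grid {d : ℕ} (s : Finset (Fin d → ℤ)) :
    ∃ N : ℕ, 0 < N ∧ ∀ k ∈ s, ∀ l ∈ s, ∀ i, |k i - l i| < N := by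
  -- The final `+ 1` makes the bound strict, and keeps `N` positive when `s` is empty.
  refine ⟨∑ k ∈ s, ∑ l ∈ s, ∑ i, (k i - l i).natAbs + 1, Nat.succ_pos _, fun k hk l hl i => ?_⟩
  have h1 : (k i - l i).natAbs ≤ ∑ i, (k i - l i).natAbs :=
    Finset.single_le_sum (f := fun i => (k i - l i).natAbs) (fun _ _ => Nat.zero_le _)
      (Finset.mem_univ i)
  have h2 : ∑ i, (k i - l i).natAbs ≤ ∑ l ∈ s, ∑ i, (k i - l i).natAbs :=
    Finset.single_le_sum (f := fun l => ∑ i, (k i - l i).natAbs) (fun _ _ => Nat.zero_le _) hl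
  have h3 : ∑ l ∈ s, ∑ i, (k i - l i).natAbs ≤ ∑ k ∈ s, ∑ l ∈ s, ∑ i, (k i - l i).natAbs :=
    Finset.single_le_sum (f := fun k => ∑ l ∈ s, ∑ i, (k i - l i).natAbs)
      (fun _ _ => Nat.zero_le _) hk
  rw [Int.abs_eq_natAbs]
  exact_mod_cast Nat.lt_succ_of_le (h1.trans (h2.trans h3))

/-- If the characters of a large finite set of frequencies, evaluated at points of the torus and
multiplied by `σ`, are within `r` of subspaces of dimension less than `n`, then the sequence `σ` is
nearly within `r` in `ℓ_2` of a sequence supported on fewer than `n` points. -/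
theorem exists_tsum_tail_le {d : ℕ} (σ : (Fin d → ℤ) → ℝ) (hσ : Summable fun k => σ k ^ 2)
    (n : ℕ) (r : ℝ)
    (h : ∀ s : Finset (Fin d → ℤ), ∃ V : Submodule ℂ (EuclideanSpace ℂ s),
      Module.finrank ℂ V < n ∧
      ∀ x : Torus d, ∃ b ∈ V,
        ‖WithLp.toLp 2 (fun k : s => (σ k : ℂ) * mFourier (-(k : Fin d → ℤ)) x) - b‖ ≤ r)
    {δ : ℝ} (hδ : 0 < δ) :
    ∃ t : Finset (Fin d → ℤ), t.card < n ∧ ∑' k : {k // k ∉ t}, σ k ^ 2 ≤ r ^ 2 + δ := by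
  -- The loss `δ` is spent here: `s` carries all of `∑ σ_k²` except less than `δ`.
  obtain ⟨s, hs⟩ := (hσ.hasSum.eventually (lt_mem_nhds (sub_lt_self _ hδ))).exists
  obtain ⟨V, hV, hVr⟩ := h s
  obtain ⟨N, hN, hNs⟩ := exists_grid s
  have : NeZero N := ⟨hN.ne'⟩
  obtain ⟨t, ht, htr⟩ := exists_sum_compl_sq_le (X := Fin d → Fin N)
    (ε := fun x (k : s) => mFourier (-(k : Fin d → ℤ)) (gridPoint x)) (fun k l => by
      simp only [mFourier_mul_star]
      rw [sum_mFourier_gridPoint fun i => ?_]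
      · simp only [neg_sub_neg, sub_eq_zero, Subtype.ext_iff, eq_comm]
      · simpa [neg_add_eq_sub] using hNs l l.2 k k.2 i)
    (fun k => σ k) V r fun x => hVr _
  refine ⟨t.map (Function.Embedding.subtype _), by rw [Finset.card_map]; omega, ?_⟩
  -- The tail off `t` is the part in `s` outside `t`, at most `r²`, plus the mass outside `s`, less
  -- than `δ`.
  have h2 := hσ.sum_add_tsum_compl (s := t.map (Function.Embedding.subtype _))
  have h3 : ∑ k ∈ t.map (Function.Embedding.subtype _), σ k ^ 2 = ∑ k ∈ t, σ k ^ 2 := by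
    rw [Finset.sum_map]; rfl
  have h4 : ∑ k ∈ s, σ k ^ 2 = ∑ k ∈ t, σ k ^ 2 + ∑ k ∈ tᶜ, σ k ^ 2 := by
    rw [Finset.sum_add_sum_compl, ← Finset.sum_coe_sort]
  have h5 : ∑' k : {k // k ∉ t.map (Function.Embedding.subtype _)}, σ k ^ 2 =
      ∑' k : ((t.map (Function.Embedding.subtype _) : Finset (Fin d → ℤ)) : Set (Fin d → ℤ))ᶜ.Elem,
        σ k ^ 2 := rfl
  linarith

/-! ### Approximation numbers -/

section ApproxNumber

variable {X Y : Type*} [SeminormedAddCommGroup X] [NormedSpace ℂ X]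
  [SeminormedAddCommGroup Y] [NormedSpace ℂ Y]

theorem approxNumber_le {n : ℕ} {T A : X →L[ℂ] Y}
    (hA : LinearMap.rank (A : X →ₗ[ℂ] Y) < (n : Cardinal)) : approxNumber n T ≤ ‖T - A‖ :=
  csInf_le ⟨0, by rintro _ ⟨A, -, rfl⟩; exact norm_nonneg _⟩ ⟨A, hA, rfl⟩

theorem le_approxNumber {n : ℕ} (hn : 1 ≤ n) {T : X →L[ℂ] Y} {c : ℝ}
    (h : ∀ A : X →L[ℂ] Y, LinearMap.rank (A : X →ₗ[ℂ] Y) < (n : Cardinal) → c ≤ ‖T - A‖) :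
    c ≤ approxNumber n T := by
  -- The zero operator qualifies because `1 ≤ n`; for `n = 0` the infimum would be over the empty
  -- set.
  refine le_csInf ⟨_, 0, ?_, rfl⟩ ?_
  · rw [ContinuousLinearMap.toLinearMap_zero, LinearMap.rank_zero]
    exact_mod_cast hn
  · rintro _ ⟨A, hA, rfl⟩
    exact h A hA

/-- A finite sum of operators of rank one. -/
theorem rank_sum_smulRight_lt {ι : Type*} [DecidableEq Y] {n : ℕ} (t : Finset ι) (ht : t.card < n)
    (φ : ι → X →L[ℂ] ℂ) (y : ι → Y) :
    LinearMap.rank ((∑ k ∈ t, (φ k).smulRight (y k) : X →L[ℂ] Y) : X →ₗ[ℂ] Y) <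
      (n : Cardinal) := by
  have hle : LinearMap.range ((∑ k ∈ t, (φ k).smulRight (y k) : X →L[ℂ] Y) : X →ₗ[ℂ] Y) ≤
      Submodule.span ℂ ((t.image y : Finset Y) : Set Y) := by
    rintro _ ⟨x, rfl⟩
    simp only [ContinuousLinearMap.coe_coe, sum_apply,
      ContinuousLinearMap.smulRight_apply]
    exact Submodule.sum_mem _ fun k hk => Submodule.smul_mem _ _
      (Submodule.subset_span (Finset.mem_coe.2 (Finset.mem_image_of_mem y hk)))
  calc _ ≤ _ := Submodule.rank_mono hle
    _ ≤ ((t.image y).card : Cardinal) := rank_span_finset_le _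
    _ < n := by exact_mod_cast Finset.card_image_le.trans_lt ht

/-- The image of an operator of rank less than `n` under a linear map. -/
theorem finrank_map_range_lt {E : Type*} [AddCommGroup E] [Module ℂ E] {n : ℕ}
    {A : X →L[ℂ] Y} (hA : LinearMap.rank (A : X →ₗ[ℂ] Y) < (n : Cardinal)) (P : Y →ₗ[ℂ] E) :
    Module.finrank ℂ ((LinearMap.range (A : X →ₗ[ℂ] Y)).map P) < n := by
  have hfin : Module.Finite ℂ (LinearMap.range (A : X →ₗ[ℂ] Y)) :=
    Module.rank_lt_aleph0_iff.1 (hA.trans (Cardinal.natCast_lt_aleph0))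
  refine (Submodule.finrank_map_le P _).trans_lt ?_
  have h : Module.rank ℂ (LinearMap.range (A : X →ₗ[ℂ] Y)) < (n : Cardinal) := hA
  rw [← Module.finrank_eq_rank] at h
  exact_mod_cast h

end ApproxNumber

/-- Rank–nullity for the adjoint, together with `ker A* = (range A)ᗮ`. -/
theorem finrank_range_adjoint {E F : Type*} [NormedAddCommGroup E] [InnerProductSpace ℂ E]
    [NormedAddCommGroup F] [InnerProductSpace ℂ F] [FiniteDimensional ℂ E] [FiniteDimensional ℂ F]
    (A : E →ₗ[ℂ] F) :
    Module.finrank ℂ (LinearMap.range A.adjoint) = Module.finrank ℂ (LinearMap.range A) := by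
  have h1 := A.adjoint.finrank_range_add_finrank_ker
  have h2 := (LinearMap.range A).finrank_add_finrank_orthogonal
  rw [LinearMap.orthogonal_range] at h2
  omega

/-! ### Fourier coefficients of characters and smooth functions -/

theorem integral_mFourier {d : ℕ} (m : Fin d → ℤ) :
    ∫ x, mFourier m x ∂torusMeasure d = if m = 0 then 1 else 0 := by
  split_ifs with h
  · simp [h, mFourier_zero]
  · obtain ⟨i, hi⟩ := Function.ne_iff.1 h
    simp only [mFourier, ContinuousMap.coe_mk, torusMeasure]
    rw [integral_fintype_prod_eq_prod (μ := fun _ : Fin d => AddCircle.haarAddCircle)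
      (fun i (t : UnitAddCircle) => (fourier (m i) t : ℂ))]
    refine Finset.prod_eq_zero (Finset.mem_univ i) ?_
    have h := orthonormal_iff_ite.1 (orthonormal_fourier (T := 1)) 0 (m i)
    rw [if_neg fun h' => hi h'.symm, ContinuousMap.inner_toLp] at h
    simpa using h

theorem integral_mFourier_mul {d : ℕ} (k l : Fin d → ℤ) :
    ∫ x, mFourier (-l) x * mFourier k x ∂torusMeasure d = if k = l then 1 else 0 := by
  simp only [← mFourier_add, integral_mFourier, neg_add_eq_zero, eq_comm]

theorem norm_mFourier_apply_le {d : ℕ} (k : Fin d → ℤ) (x : Torus d) : ‖mFourier k x‖ ≤ 1 :=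
  ((mFourier k).norm_coe_le_norm x).trans mFourier_norm.le

theorem exists_lift_eq {d : ℕ} (x : Torus d) :
    ∃ y : Fin d → ℝ, (fun i => (y i : UnitAddCircle)) = x := by
  choose y hy using fun i => QuotientAddGroup.mk_surjective (x i)
  exact ⟨y, funext hy⟩

/-- The covering `ℝ^d → 𝕋^d` is a quotient map, so continuity descends from the smooth lift. -/
theorem continuous_testFunction {d : ℕ} (φ : TestFunctions d) :
    Continuous (φ : Torus d → ℂ) := by
  have h : Continuous (lift (φ : Torus d → ℂ)) := ContDiff.continuous (𝕜 := ℝ) (n := ∞) φ.2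
  have hq : IsOpenQuotientMap fun (y : Fin d → ℝ) (i : Fin d) => (y i : UnitAddCircle) :=
    IsOpenQuotientMap.piMap fun _ => QuotientAddGroup.isOpenQuotientMap_mk
  exact hq.isQuotientMap.continuous_iff.2 h

theorem norm_testFunction_le {d : ℕ} {φ : TestFunctions d} {M : ℝ}
    (h : ∀ m ≤ 0, ∀ x, ‖iteratedFDeriv ℝ m (lift (φ : Torus d → ℂ)) x‖ ≤ M) (x : Torus d) :
    ‖(φ : Torus d → ℂ) x‖ ≤ M := by
  obtain ⟨y, rfl⟩ := exists_lift_eq x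
  simpa [lift] using h 0 le_rfl y

/-- A linear functional on the smooth functions bounded by the supremum norm is a distribution. -/
theorem mem_distributions_of_bound {d : ℕ} (u : Module.Dual ℂ (TestFunctions d)) (C : ℝ)
    (h : ∀ (φ : TestFunctions d) (M : ℝ), (∀ x, ‖(φ : Torus d → ℂ) x‖ ≤ M) → ‖u φ‖ ≤ C * M) :
    u ∈ Distributions d :=
  ⟨C, 0, fun φ M hM => h φ M (norm_testFunction_le hM)⟩

/-! ### The characters as elements of the function and distribution spaces -/

/-- The character with frequency `k` in `L_1`. -/
def charL1 {d : ℕ} (k : Fin d → ℤ) : L1 d :=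
  ContinuousMap.toLp (E := ℂ) 1 (torusMeasure d) ℂ (mFourier k)

theorem coeffL1_charL1 {d : ℕ} (k l : Fin d → ℤ) :
    coeffL1 (charL1 k) l = if k = l then 1 else 0 := by
  rw [← integral_mFourier_mul]
  refine integral_congr_ae ?_
  filter_upwards [ContinuousMap.coeFn_toLp (𝕜 := ℂ) (p := 1) (torusMeasure d) (mFourier k)]
    with x hx
  rw [charL1, hx]

theorem integrable_mul_testFunction {d : ℕ} (k : Fin d → ℤ) (φ : TestFunctions d) :
    Integrable (fun x => mFourier k x * (φ : Torus d → ℂ) x) (torusMeasure d) :=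
  ((mFourier k).continuous.mul (continuous_testFunction φ)).integrable_of_hasCompactSupport
    (HasCompactSupport.of_compactSpace _)

/-- The character with frequency `k` as a distribution. -/
def charD {d : ℕ} (k : Fin d → ℤ) : Distributions d :=
  ⟨{ toFun := fun φ => ∫ x, mFourier k x * (φ : Torus d → ℂ) x ∂torusMeasure d
     map_add' := fun φ ψ => by
       simp only [Submodule.coe_add, Pi.add_apply, mul_add]
       exact integral_add (integrable_mul_testFunction k φ) (integrable_mul_testFunction k ψ)
     map_smul' := fun c φ => by
       simp only [Submodule.coe_smul, Pi.smul_apply, smul_eq_mul, RingHom.id_apply,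
         mul_left_comm _ c]
       exact integral_const_mul c _ },
    mem_distributions_of_bound _ 1 fun φ M hM => by
      refine (norm_integral_le_of_norm_le_const (C := M)
        (Filter.Eventually.of_forall fun x => ?_)).trans (by simp)
      rw [norm_mul]
      exact (mul_le_of_le_one_left (norm_nonneg _) (norm_mFourier_apply_le k x)).trans (hM x)⟩

theorem coeffD_charD {d : ℕ} (k l : Fin d → ℤ) :
    coeffD (charD k) l = if k = l then 1 else 0 := by
  rw [← integral_mFourier_mul]
  exact integral_congr_ae (Filter.Eventually.of_forall fun x => mul_comm _ _)

/-! ### Integration against complex measures -/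

section ComplexIntegral

variable {X : Type*} {mX : MeasurableSpace X}

/-- Both sides agree on indicators; additivity, `L_1` continuity and a.e. invariance extend this to
all integrable functions. -/
theorem setToFun_const_mul_left {m : Measure X} {T T' : Set X → ℂ →L[ℝ] ℂ} {C C' : ℝ}
    (hT : DominatedFinMeasAdditive m T C) (hT' : DominatedFinMeasAdditive m T' C') (c : ℂ)
    (h : ∀ s, MeasurableSet s → ∀ z, T' s z = c * T s z) {f : X → ℂ} (hf : Integrable f m) :
    setToFun m T' hT' f = c * setToFun m T hT f := by
  refine Integrable.induction (fun f => setToFun m T' hT' f = c * setToFun m T hT f)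
    (fun z s hs hms => ?_) (fun f g _ hf hg h1 h2 => ?_) ?_ (fun f g hfg _ h1 => ?_) hf
  · simp only [setToFun_indicator_const _ hs hms.ne, h s hs]
  · simp only [setToFun_add _ hf hg, h1, h2, mul_add]
  · exact isClosed_eq (continuous_setToFun hT') (continuous_const.mul (continuous_setToFun hT))
  · simp only [← setToFun_congr_ae _ hfg, h1]

variable (μ : ComplexMeasure X)

theorem integral_const_smul (c : ℂ) (f : X → ℂ) :
    VectorMeasure.integral μ (c • f) (ContinuousLinearMap.mul ℝ ℂ) =
      c * VectorMeasure.integral μ f (ContinuousLinearMap.mul ℝ ℂ) := by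
  refine setToFun_smul (𝕜 := ℂ) _ (fun c s x => ?_) c f
  change (c * x) * μ s = c * (x * μ s)
  ring

/-- The two integrals are extensions relative to different variations. Both are first rewritten over
the sum of the variations, where the set functions differ by the factor `c`. -/
theorem integral_const_smul_measure (c : ℂ) {f : X → ℂ} (hf : Integrable f μ.variation)
    (hf' : Integrable f (c • μ).variation) :
    VectorMeasure.integral (c • μ) f (ContinuousLinearMap.mul ℝ ℂ) =
      c * VectorMeasure.integral μ f (ContinuousLinearMap.mul ℝ ℂ) := by
  have hC : 0 ≤ ‖ContinuousLinearMap.mul ℝ ℂ‖ :=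
    (ContinuousLinearMap.mul ℝ ℂ).opNorm_nonneg
  have h1 := dominatedFinMeasAdditive_cbmApplyMeasure μ (ContinuousLinearMap.mul ℝ ℂ)
  have h2 := dominatedFinMeasAdditive_cbmApplyMeasure (c • μ) (ContinuousLinearMap.mul ℝ ℂ)
  have hle1 : μ.variation ≤ μ.variation + (c • μ).variation := Measure.le_add_right le_rfl
  have hle2 : (c • μ).variation ≤ μ.variation + (c • μ).variation := Measure.le_add_left le_rfl
  have h1' := h1.of_measure_le hle1 hC
  have h2' := h2.of_measure_le hle2 hC
  have hfm := hf.add_measure hf'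
  simp only [VectorMeasure.integral_eq_setToFun]
  rw [← setToFun_congr_measure_of_integrable 1 ENNReal.one_ne_top (by simpa using hle1) h1' h1 f hfm,
    ← setToFun_congr_measure_of_integrable 1 ENNReal.one_ne_top (by simpa using hle2) h2' h2 f hfm]
  refine setToFun_const_mul_left h1' h2' c (fun s _ z => ?_) hfm
  change z * (c * μ s) = c * (z * μ s)
  ring

end ComplexIntegral

/-! ### Complex measures as distributions -/

namespace MSpace

variable {d : ℕ}

instance (μ : MSpace d) : IsFiniteMeasure μ.toMeasure.variation :=
  ⟨μ.variation_ne_top.lt_top⟩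

theorem integrable_testFunction (μ : MSpace d) (φ : TestFunctions d) :
    Integrable (φ : Torus d → ℂ) μ.toMeasure.variation :=
  (continuous_testFunction φ).integrable_of_hasCompactSupport
    (HasCompactSupport.of_compactSpace _)

theorem norm_integral_le (μ : MSpace d) {f : Torus d → ℂ} {M : ℝ} (hM : ∀ x, ‖f x‖ ≤ M) :
    ‖VectorMeasure.integral μ.toMeasure f (ContinuousLinearMap.mul ℝ ℂ)‖ ≤ ‖μ‖ * M := by
  have h := VectorMeasure.norm_integral_le_of_norm_le_const (μ := μ.toMeasure)
    (B := ContinuousLinearMap.mul ℝ ℂ) (Filter.Eventually.of_forall hM)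
  have h1 : ‖ContinuousLinearMap.mul ℝ ℂ‖ = 1 := ContinuousLinearMap.opNorm_mul ℝ ℂ
  rw [h1, mul_one, mul_comm] at h
  exact h

/-- The distribution `φ ↦ ∫ φ dμ`. -/
def toDistribution (μ : MSpace d) : Distributions d :=
  ⟨{ toFun := fun φ => VectorMeasure.integral μ.toMeasure (φ : Torus d → ℂ)
       (ContinuousLinearMap.mul ℝ ℂ)
     map_add' := fun φ ψ =>
       VectorMeasure.integral_add (integrable_testFunction μ φ) (integrable_testFunction μ ψ)
     map_smul' := fun c _ => integral_const_smul μ.toMeasure c _ },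
    mem_distributions_of_bound _ ‖μ‖ fun _ _ hM => norm_integral_le μ hM⟩

theorem norm_coeffD_toDistribution_le (μ : MSpace d) (k : Fin d → ℤ) :
    ‖coeffD μ.toDistribution k‖ ≤ ‖μ‖ :=
  (norm_integral_le μ (norm_mFourier_apply_le (-k))).trans_eq (mul_one _)

theorem toDistribution_add (μ ν : MSpace d) :
    (μ + ν).toDistribution = μ.toDistribution + ν.toDistribution :=
  Subtype.ext <| LinearMap.ext fun φ => VectorMeasure.integral_add_vectorMeasure
    (integrable_testFunction μ φ) (integrable_testFunction ν φ)

theorem toDistribution_smul (c : ℂ) (μ : MSpace d) :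
    (c • μ).toDistribution = c • μ.toDistribution :=
  Subtype.ext <| LinearMap.ext fun φ => integral_const_smul_measure μ.toMeasure c
    (integrable_testFunction μ φ) (integrable_testFunction (c • μ) φ)

/-- The embedding of the complex measures into the distributions with bounded Fourier
coefficients. -/
def toBSpace : MSpace d →L[ℂ] BSpace d :=
  LinearMap.mkContinuous
    { toFun := fun μ => (⟨μ.toDistribution, ‖μ‖, by
        rintro _ ⟨k, rfl⟩
        exact norm_coeffD_toDistribution_le μ k⟩ : BSubmodule d)
      map_add' := fun μ ν => Subtype.ext (toDistribution_add μ ν)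
      map_smul' := fun c μ => Subtype.ext (toDistribution_smul c μ) }
    1 fun μ => by
      rw [one_mul]
      exact ciSup_le fun k => norm_coeffD_toDistribution_le μ k

theorem norm_toBSpace_le : ‖(toBSpace : MSpace d →L[ℂ] BSpace d)‖ ≤ 1 :=
  LinearMap.mkContinuous_norm_le _ zero_le_one _

/-- The unit point mass at `x`. -/
def dirac (x : Torus d) : MSpace d := VectorMeasure.dirac x (1 : ℂ)

theorem norm_dirac_le (x : Torus d) : ‖dirac x‖ ≤ 1 := by
  change ((VectorMeasure.dirac x (1 : ℂ)).variation Set.univ).toReal ≤ 1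
  rw [VectorMeasure.variation_dirac]
  simp

/-- Point masses thus supply, inside the unit ball of `ℳ`, every row of character values needed for
the lower bound. -/
theorem coeffD_dirac (x : Torus d) (k : Fin d → ℤ) :
    coeffD (dirac x).toDistribution k = mFourier (-k) x := by
  change VectorMeasure.integral (VectorMeasure.dirac x (1 : ℂ)) (mFourier (-k))
    (ContinuousLinearMap.mul ℝ ℂ) = _
  rw [VectorMeasure.integral_dirac]
  simp

end MSpace

/-! ### Fourier coefficients as functionals -/

namespace BSpace

variable {d : ℕ}

theorem norm_coeffD_le (g : BSpace d) (k : Fin d → ℤ) : ‖coeffD g.toD k‖ ≤ ‖g‖ :=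
  le_ciSup (f := fun k => ‖coeffD g.toD k‖) g.2 k

/-- The Fourier coefficient with frequency `k` as a bounded functional. -/
def coeff (k : Fin d → ℤ) : BSpace d →L[ℂ] ℂ :=
  LinearMap.mkContinuous
    { toFun := fun g => coeffD g.toD k
      map_add' := fun f g => coeffD_add f.toD g.toD k
      map_smul' := fun c g => coeffD_smul c g.toD k }
    1 fun g => by
      rw [one_mul]
      exact norm_coeffD_le g k

theorem coeff_apply (k : Fin d → ℤ) (g : BSpace d) : coeff k g = coeffD g.toD k := rfl

end BSpace

namespace DFd

variable {d : ℕ} {v : (Fin d → ℤ) → ℝ}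

theorem summable_coeff (g : DFd v) : Summable fun k => v k ^ 2 * ‖coeffD g.toD k‖ ^ 2 := g.2

theorem norm_def (g : DFd v) : ‖g‖ = √(∑' k, v k ^ 2 * ‖coeffD g.toD k‖ ^ 2) := rfl

theorem norm_sq (g : DFd v) : ‖g‖ ^ 2 = ∑' k, v k ^ 2 * ‖coeffD g.toD k‖ ^ 2 :=
  Real.sq_sqrt (tsum_nonneg fun _ => by positivity)

/-- The Fourier coefficient with frequency `k` as a functional. -/
def coeff (k : Fin d → ℤ) : DFd v →ₗ[ℂ] ℂ where
  toFun g := coeffD g.toD k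
  map_add' f g := coeffD_add f.toD g.toD k
  map_smul' c g := coeffD_smul c g.toD k

theorem coeff_apply (k : Fin d → ℤ) (g : DFd v) : coeff k g = coeffD g.toD k := rfl

/-- The character with frequency `k`. -/
def char (k : Fin d → ℤ) : DFd v :=
  (⟨charD k, summable_of_ne_finset_zero (s := {k}) fun l hl => by
    rw [coeffD_charD, if_neg fun h => hl (by simp [h])]
    simp⟩ : DFdSubmodule v)

theorem coeffD_char (k l : Fin d → ℤ) : coeffD (char k : DFd v).toD l = if k = l then 1 else 0 :=
  coeffD_charD k l

/-- The weighted Fourier coefficients with frequencies in a finite set. -/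
def weightedCoeff (v : (Fin d → ℤ) → ℝ) (s : Finset (Fin d → ℤ)) :
    DFd v →ₗ[ℂ] EuclideanSpace ℂ s :=
  (WithLp.linearEquiv 2 ℂ (s → ℂ)).symm.toLinearMap ∘ₗ
    LinearMap.pi fun k : s => (v k : ℂ) • coeff (k : Fin d → ℤ)

theorem weightedCoeff_apply (s : Finset (Fin d → ℤ)) (g : DFd v) :
    weightedCoeff v s g = WithLp.toLp 2 fun k : s => (v k : ℂ) * coeffD g.toD k := rfl

theorem norm_weightedCoeff_le (s : Finset (Fin d → ℤ)) (g : DFd v) :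
    ‖weightedCoeff v s g‖ ≤ ‖g‖ := by
  refine le_of_sq_le_sq ?_ (norm_nonneg g)
  rw [weightedCoeff_apply, EuclideanSpace.norm_sq_eq, norm_sq]
  simp only [norm_mul, mul_pow, Complex.norm_real, Real.norm_eq_abs, sq_abs]
  rw [Finset.sum_coe_sort s fun k => v k ^ 2 * ‖coeffD g.toD k‖ ^ 2]
  exact g.summable_coeff.sum_le_tsum s fun _ _ => by positivity

end DFd

namespace Wiener

variable {d : ℕ}

theorem summable_coeff (f : Wiener d) : Summable fun k => ‖coeffL1 f.toL1 k‖ := f.2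

theorem norm_def (f : Wiener d) : ‖f‖ = ∑' k, ‖coeffL1 f.toL1 k‖ := rfl

/-- The Fourier coefficient with frequency `k` as a functional. -/
def coeff (k : Fin d → ℤ) : Wiener d →ₗ[ℂ] ℂ where
  toFun g := coeffL1 g.toL1 k
  map_add' f g := coeffL1_add f.toL1 g.toL1 k
  map_smul' c g := coeffL1_smul c g.toL1 k

theorem coeff_apply (k : Fin d → ℤ) (f : Wiener d) : coeff k f = coeffL1 f.toL1 k := rfl

/-- The character with frequency `k`. -/
def char (k : Fin d → ℤ) : Wiener d :=
  (⟨charL1 k, summable_of_ne_finset_zero (s := {k}) fun l hl => by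
    rw [coeffL1_charL1, if_neg fun h => hl (by simp [h])]
    simp⟩ : WienerSubmodule d)

theorem coeffL1_char (k l : Fin d → ℤ) : coeffL1 (char k).toL1 l = if k = l then 1 else 0 :=
  coeffL1_charL1 k l

/-- The Fourier coefficients with frequencies in a finite set. -/
def finCoeff (s : Finset (Fin d → ℤ)) : Wiener d →ₗ[ℂ] EuclideanSpace ℂ s :=
  (WithLp.linearEquiv 2 ℂ (s → ℂ)).symm.toLinearMap ∘ₗ
    LinearMap.pi fun k : s => coeff (k : Fin d → ℤ)

theorem finCoeff_apply (s : Finset (Fin d → ℤ)) (f : Wiener d) (k : s) :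
    finCoeff s f k = coeffL1 f.toL1 k := rfl

/-- The Wiener norm dominates the finite sums of the Fourier series. -/
theorem norm_inner_finCoeff_le (s : Finset (Fin d → ℤ)) (f : Wiener d) (e : EuclideanSpace ℂ s)
    (he : ∀ k, ‖e k‖ ≤ 1) : ‖inner ℂ e (finCoeff s f)‖ ≤ ‖f‖ := by
  rw [PiLp.inner_apply]
  calc _ ≤ ∑ k : s, ‖coeffL1 f.toL1 k‖ := norm_sum_le_of_le _ fun k _ => by
        rw [finCoeff_apply]
        exact (norm_inner_le_norm _ _).trans (mul_le_of_le_one_left (norm_nonneg _) (he k))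
    _ = ∑ k ∈ s, ‖coeffL1 f.toL1 k‖ := Finset.sum_coe_sort s fun k => ‖coeffL1 f.toL1 k‖
    _ ≤ ‖f‖ := f.summable_coeff.sum_le_tsum s fun _ _ => norm_nonneg _

end Wiener

namespace Fd

variable {d : ℕ} {w : (Fin d → ℤ) → ℝ}

theorem summable_coeff (f : Fd w) : Summable fun k => w k ^ 2 * ‖coeffL1 f.toL1 k‖ ^ 2 := f.2

theorem norm_sq (f : Fd w) : ‖f‖ ^ 2 = ∑' k, w k ^ 2 * ‖coeffL1 f.toL1 k‖ ^ 2 :=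
  Real.sq_sqrt (tsum_nonneg fun _ => by positivity)

/-- The Fourier coefficient with frequency `k` as a bounded functional. -/
def coeff (hw : ∀ k, 0 < w k) (k : Fin d → ℤ) : Fd w →L[ℂ] ℂ :=
  LinearMap.mkContinuous
    { toFun := fun g => coeffL1 g.toL1 k
      map_add' := fun f g => coeffL1_add f.toL1 g.toL1 k
      map_smul' := fun c g => coeffL1_smul c g.toL1 k }
    (w k)⁻¹ fun f => by
      rw [← div_eq_inv_mul, le_div_iff₀ (hw k), mul_comm]
      refine le_of_sq_le_sq ?_ (norm_nonneg f)
      rw [mul_pow, norm_sq]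
      exact f.summable_coeff.le_tsum k fun _ _ => by positivity

theorem coeff_apply (hw : ∀ k, 0 < w k) (k : Fin d → ℤ) (f : Fd w) :
    coeff hw k f = coeffL1 f.toL1 k := rfl

/-- The character with frequency `k`. -/
def char (k : Fin d → ℤ) : Fd w :=
  (⟨charL1 k, summable_of_ne_finset_zero (s := {k}) fun l hl => by
    rw [coeffL1_charL1, if_neg fun h => hl (by simp [h])]
    simp⟩ : FdSubmodule w)

theorem coeff_char (hw : ∀ k, 0 < w k) (k l : Fin d → ℤ) :
    coeff hw l (char k) = if k = l then 1 else 0 :=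
  coeffL1_charL1 k l

/-- The trigonometric polynomial `∑ c_k w(k)⁻¹ e_k` over a finite set of frequencies; this is an
isometric embedding. -/
def trigPoly (w : (Fin d → ℤ) → ℝ) (s : Finset (Fin d → ℤ)) : EuclideanSpace ℂ s →ₗ[ℂ] Fd w :=
  ∑ k : s, (((1 / w k : ℝ) : ℂ) • (EuclideanSpace.proj k).toLinearMap).smulRight
    (char (k : Fin d → ℤ))

theorem coeff_trigPoly (hw : ∀ k, 0 < w k) (s : Finset (Fin d → ℤ)) (c : EuclideanSpace ℂ s)
    (l : Fin d → ℤ) :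
    coeffL1 (trigPoly w s c).toL1 l =
      if h : l ∈ s then ((1 / w l : ℝ) : ℂ) * c ⟨l, h⟩ else 0 := by
  rw [← coeff_apply hw]
  simp only [trigPoly, LinearMap.sum_apply, LinearMap.smulRight_apply, LinearMap.smul_apply,
    map_sum, map_smul, coeff_char, smul_eq_mul, mul_ite, mul_one, mul_zero]
  split_ifs with h
  · rw [Finset.sum_eq_single ⟨l, h⟩]
    · simp
    · exact fun k _ hk => if_neg fun h' => hk (Subtype.ext h')
    · simp
  · exact Finset.sum_eq_zero fun k _ => if_neg fun h' : (k : Fin d → ℤ) = l => h (h' ▸ k.2)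

theorem norm_trigPoly (hw : ∀ k, 0 < w k) (s : Finset (Fin d → ℤ)) (c : EuclideanSpace ℂ s) :
    ‖trigPoly w s c‖ = ‖c‖ := by
  rw [← sq_eq_sq₀ (norm_nonneg _) (norm_nonneg _), norm_sq, EuclideanSpace.norm_sq_eq,
    tsum_eq_sum (s := s) fun k hk => by rw [coeff_trigPoly hw, dif_neg hk]; simp,
    ← Finset.sum_coe_sort]
  refine Finset.sum_congr rfl fun k _ => ?_
  rw [coeff_trigPoly hw, dif_pos k.2, norm_mul, Complex.norm_real, Real.norm_eq_abs, mul_pow,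
    sq_abs, ← mul_assoc, ← mul_pow, mul_one_div_cancel (hw k).ne', one_pow, one_mul]

end Fd

/-! ### Cauchy–Schwarz estimates and the three embeddings -/

theorem summable_mul_and_tsum_mul_le {ι : Type*} {a b : ι → ℝ} (ha : ∀ k, 0 ≤ a k)
    (hb : ∀ k, 0 ≤ b k) (ha2 : Summable fun k => a k ^ 2) (hb2 : Summable fun k => b k ^ 2) :
    (Summable fun k => a k * b k) ∧
      ∑' k, a k * b k ≤ √(∑' k, a k ^ 2) * √(∑' k, b k ^ 2) := by
  have h := Real.summable_and_inner_le_Lp_mul_Lq_tsum_of_nonneg Real.HolderConjugate.two_two ha hb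
    (by simpa using ha2) (by simpa using hb2)
  simpa [Real.sqrt_eq_rpow] using h

section Embeddings

variable {d : ℕ} {w : (Fin d → ℤ) → ℝ}

/-- The multiplier `τ` is kept general: `τ = 1/w` bounds the embedding, and `1/w` set to zero on a
finite set bounds the truncation error. -/
theorem Fd.summable_mul_and_tsum_le (hw : ∀ k, 0 < w k) {τ : (Fin d → ℤ) → ℝ}
    (hτ : ∀ k, 0 ≤ τ k) (hτ2 : Summable fun k => τ k ^ 2) (f : Fd w) :
    (Summable fun k => τ k * (w k * ‖coeffL1 f.toL1 k‖)) ∧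
      ∑' k, τ k * (w k * ‖coeffL1 f.toL1 k‖) ≤ √(∑' k, τ k ^ 2) * ‖f‖ := by
  have h := summable_mul_and_tsum_mul_le (b := fun k => w k * ‖coeffL1 f.toL1 k‖) hτ
    (fun k => mul_nonneg (hw k).le (norm_nonneg _)) hτ2 (by simpa [mul_pow] using f.summable_coeff)
  simpa only [mul_pow, ← Fd.norm_sq, Real.sqrt_sq (norm_nonneg f)] using h

theorem Fd.summable_and_tsum_norm_coeffL1_le (hw : ∀ k, 0 < w k)
    (hσ : Summable fun k => (1 / w k) ^ 2) (f : Fd w) :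
    (Summable fun k => ‖coeffL1 f.toL1 k‖) ∧
      ∑' k, ‖coeffL1 f.toL1 k‖ ≤ √(∑' k, (1 / w k) ^ 2) * ‖f‖ := by
  have hmul : ∀ k, (1 / w k) * (w k * ‖coeffL1 f.toL1 k‖) = ‖coeffL1 f.toL1 k‖ := fun k => by
    rw [← mul_assoc, one_div_mul_cancel (hw k).ne', one_mul]
  simpa only [hmul] using
    Fd.summable_mul_and_tsum_le hw (fun k => (one_div_pos.2 (hw k)).le) hσ f

theorem BSpace.summable_mul_and_sqrt_tsum_le {τ : (Fin d → ℤ) → ℝ}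
    (hτ2 : Summable fun k => τ k ^ 2) (g : BSpace d) :
    (Summable fun k => τ k ^ 2 * ‖coeffD g.toD k‖ ^ 2) ∧
      √(∑' k, τ k ^ 2 * ‖coeffD g.toD k‖ ^ 2) ≤ √(∑' k, τ k ^ 2) * ‖g‖ := by
  have hle : ∀ k, τ k ^ 2 * ‖coeffD g.toD k‖ ^ 2 ≤ τ k ^ 2 * ‖g‖ ^ 2 := fun k =>
    mul_le_mul_of_nonneg_left (pow_le_pow_left₀ (norm_nonneg _) (g.norm_coeffD_le k) 2)
      (sq_nonneg _)
  have hs : Summable fun k => τ k ^ 2 * ‖coeffD g.toD k‖ ^ 2 :=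
    (hτ2.mul_right (‖g‖ ^ 2)).of_nonneg_of_le (fun k => by positivity) hle
  refine ⟨hs, ?_⟩
  rw [← Real.sqrt_sq (norm_nonneg g), ← Real.sqrt_mul (tsum_nonneg fun _ => sq_nonneg _),
    ← tsum_mul_right]
  exact Real.sqrt_le_sqrt (hs.tsum_le_tsum hle (hτ2.mul_right _))

/-- The embedding of `F_d(w)` into the Wiener algebra. -/
def embFdWiener (hw : ∀ k, 0 < w k) (hσ : Summable fun k => (1 / w k) ^ 2) :
    Fd w →L[ℂ] Wiener d :=
  LinearMap.mkContinuous
    { toFun := fun f => (⟨f.toL1, (f.summable_and_tsum_norm_coeffL1_le hw hσ).1⟩ : WienerSubmodule d)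
      map_add' := fun _ _ => rfl
      map_smul' := fun _ _ => rfl }
    (√(∑' k, (1 / w k) ^ 2)) fun f =>
      (f.summable_and_tsum_norm_coeffL1_le hw hσ).2

theorem toL1_embFdWiener (hw : ∀ k, 0 < w k) (hσ : Summable fun k => (1 / w k) ^ 2) (f : Fd w) :
    (embFdWiener hw hσ f).toL1 = f.toL1 := rfl

/-- The embedding of the distributions with bounded Fourier coefficients into `F_d(1/w)`. -/
def embBSpaceDFd (hσ : Summable fun k => (1 / w k) ^ 2) : BSpace d →L[ℂ] DFd fun k => 1 / w k :=
  LinearMap.mkContinuous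
    { toFun := fun g =>
        (⟨g.toD, (BSpace.summable_mul_and_sqrt_tsum_le hσ g).1⟩ : DFdSubmodule fun k => 1 / w k)
      map_add' := fun _ _ => rfl
      map_smul' := fun _ _ => rfl }
    (√(∑' k, (1 / w k) ^ 2)) fun g => (BSpace.summable_mul_and_sqrt_tsum_le hσ g).2

theorem toD_embBSpaceDFd (hσ : Summable fun k => (1 / w k) ^ 2) (g : BSpace d) :
    (embBSpaceDFd hσ g).toD = g.toD := rfl

/-- The embedding of the complex measures into `F_d(1/w)`. -/
def embMSpaceDFd (hσ : Summable fun k => (1 / w k) ^ 2) : MSpace d →L[ℂ] DFd fun k => 1 / w k :=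
  (embBSpaceDFd hσ).comp MSpace.toBSpace

theorem toD_embMSpaceDFd (hσ : Summable fun k => (1 / w k) ^ 2) (μ : MSpace d) :
    (embMSpaceDFd hσ μ).toD = μ.toDistribution := rfl

/-! ### Upper bounds by truncation of the Fourier series -/

theorem sq_truncate (σ : (Fin d → ℤ) → ℝ) (t : Finset (Fin d → ℤ)) :
    (fun k => (if k ∈ t then 0 else σ k) ^ 2) = {k | k ∉ t}.indicator fun k => σ k ^ 2 := by
  funext k
  by_cases hk : k ∈ t <;> simp [hk]

theorem approxNumber_embFdWiener_le (hw : ∀ k, 0 < w k) (hσ : Summable fun k => (1 / w k) ^ 2)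
    {n : ℕ} (t : Finset (Fin d → ℤ)) (ht : t.card < n) :
    approxNumber n (embFdWiener hw hσ) ≤ √(∑' k : {k // k ∉ t}, (1 / w k) ^ 2) := by
  classical
  -- The competitor is the partial Fourier sum over `t`; the error keeps exactly the coefficients
  -- off `t`.
  refine (approxNumber_le (rank_sum_smulRight_lt t ht (Fd.coeff hw) Wiener.char)).trans
    (ContinuousLinearMap.opNorm_le_bound _ (Real.sqrt_nonneg _) fun f => ?_)
  set τ : (Fin d → ℤ) → ℝ := fun k => if k ∈ t then 0 else 1 / w k with hτ
  have h := (Fd.summable_mul_and_tsum_le hw (τ := τ)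
    (fun k => by rw [hτ]; dsimp only; split_ifs; exacts [le_rfl, (one_div_pos.2 (hw k)).le])
    (by rw [hτ, sq_truncate]; exact hσ.indicator _) f).2
  have h1 : ∑' k, τ k ^ 2 = ∑' k : {k // k ∉ t}, (1 / w k) ^ 2 := by
    rw [hτ, sq_truncate]
    exact (tsum_subtype {k | k ∉ t} fun k => (1 / w k) ^ 2).symm
  rw [h1] at h
  refine le_trans (le_of_eq ?_) h
  rw [Wiener.norm_def]
  refine tsum_congr fun l => ?_
  rw [← Wiener.coeff_apply]
  simp only [sub_apply, sum_apply, ContinuousLinearMap.smulRight_apply,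
    map_sub, map_sum, map_smul, Wiener.coeffL1_char, Wiener.coeff_apply, toL1_embFdWiener,
    Fd.coeff_apply, smul_eq_mul, mul_ite, mul_one, mul_zero, Finset.sum_ite_eq']
  rw [hτ]
  by_cases hl : l ∈ t
  · simp [hl]
  · simp only [hl, if_false, sub_zero]
    rw [← mul_assoc, one_div_mul_cancel (hw l).ne', one_mul]

theorem approxNumber_embBSpaceDFd_le (hσ : Summable fun k => (1 / w k) ^ 2)
    {n : ℕ} (t : Finset (Fin d → ℤ)) (ht : t.card < n) :
    approxNumber n (embBSpaceDFd hσ) ≤ √(∑' k : {k // k ∉ t}, (1 / w k) ^ 2) := by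
  classical
  refine (approxNumber_le (rank_sum_smulRight_lt t ht BSpace.coeff DFd.char)).trans
    (ContinuousLinearMap.opNorm_le_bound _ (Real.sqrt_nonneg _) fun g => ?_)
  set τ : (Fin d → ℤ) → ℝ := fun k => if k ∈ t then 0 else 1 / w k with hτ
  have h := (BSpace.summable_mul_and_sqrt_tsum_le (τ := τ)
    (by rw [hτ, sq_truncate]; exact hσ.indicator _) g).2
  have h1 : ∑' k, τ k ^ 2 = ∑' k : {k // k ∉ t}, (1 / w k) ^ 2 := by
    rw [hτ, sq_truncate]
    exact (tsum_subtype {k | k ∉ t} fun k => (1 / w k) ^ 2).symm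
  rw [h1] at h
  refine le_trans (le_of_eq ?_) h
  rw [DFd.norm_def]
  congr 1
  refine tsum_congr fun l => ?_
  rw [← DFd.coeff_apply]
  simp only [sub_apply, sum_apply, ContinuousLinearMap.smulRight_apply,
    map_sub, map_sum, map_smul, DFd.coeffD_char, DFd.coeff_apply, toD_embBSpaceDFd,
    BSpace.coeff_apply, smul_eq_mul, mul_ite, mul_one, mul_zero, Finset.sum_ite_eq']
  rw [hτ]
  by_cases hl : l ∈ t <;> simp [hl]

/-! ### Lower bounds -/

/-- The subspace is the image of the range of `A` under the weighted coefficients on `s`. It is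
tested on `dirac x`, so the distance is at most `‖embMSpaceDFd hσ - A‖`. -/
theorem exists_tsum_tail_le_embMSpaceDFd (hσ : Summable fun k => (1 / w k) ^ 2) {n : ℕ}
    {A : MSpace d →L[ℂ] DFd fun k => 1 / w k}
    (hA : LinearMap.rank (A : MSpace d →ₗ[ℂ] DFd fun k => 1 / w k) < (n : Cardinal))
    {δ : ℝ} (hδ : 0 < δ) :
    ∃ t : Finset (Fin d → ℤ), t.card < n ∧
      ∑' k : {k // k ∉ t}, (1 / w k) ^ 2 ≤ ‖embMSpaceDFd hσ - A‖ ^ 2 + δ := by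
  refine exists_tsum_tail_le (fun k => 1 / w k) hσ n _ (fun s => ?_) hδ
  refine ⟨_, finrank_map_range_lt hA (DFd.weightedCoeff (fun k => 1 / w k) s), fun x =>
    ⟨_, Submodule.mem_map_of_mem ⟨MSpace.dirac x, rfl⟩, ?_⟩⟩
  have h1 : WithLp.toLp 2 (fun k : s => ((1 / w k : ℝ) : ℂ) * mFourier (-(k : Fin d → ℤ)) x) =
      DFd.weightedCoeff (fun k => 1 / w k) s (embMSpaceDFd hσ (MSpace.dirac x)) := by
    rw [DFd.weightedCoeff_apply]
    simp only [toD_embMSpaceDFd, MSpace.coeffD_dirac]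
  rw [h1, ContinuousLinearMap.coe_coe, ← map_sub, ← sub_apply]
  exact (DFd.norm_weightedCoeff_le s _).trans ((embMSpaceDFd hσ - A).le_of_opNorm_le_of_le le_rfl
    (MSpace.norm_dirac_le x) |>.trans_eq (mul_one _))

/-- The argument runs on the dual side: a character vector pairs with Wiener coefficients as a
functional of norm at most one, and the adjoint of `embFdWiener hw hσ - A` carries it into the
Hilbert space. -/
theorem exists_tsum_tail_le_embFdWiener (hw : ∀ k, 0 < w k)
    (hσ : Summable fun k => (1 / w k) ^ 2) {n : ℕ} {A : Fd w →L[ℂ] Wiener d}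
    (hA : LinearMap.rank (A : Fd w →ₗ[ℂ] Wiener d) < (n : Cardinal))
    {δ : ℝ} (hδ : 0 < δ) :
    ∃ t : Finset (Fin d → ℤ), t.card < n ∧
      ∑' k : {k // k ∉ t}, (1 / w k) ^ 2 ≤ ‖embFdWiener hw hσ - A‖ ^ 2 + δ := by
  refine exists_tsum_tail_le (fun k => 1 / w k) hσ n _ (fun s => ?_) hδ
  -- The compression of `A` to the frequencies in `s`; the same compression of the embedding is the
  -- diagonal matrix `1/w`.
  set B : EuclideanSpace ℂ s →ₗ[ℂ] EuclideanSpace ℂ s :=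
    Wiener.finCoeff s ∘ₗ (A : Fd w →ₗ[ℂ] Wiener d) ∘ₗ Fd.trigPoly w s
  refine ⟨LinearMap.range B.adjoint, ?_, fun x => ?_⟩
  · rw [finrank_range_adjoint]
    refine (Submodule.finrank_mono ?_).trans_lt (finrank_map_range_lt hA (Wiener.finCoeff s))
    rintro _ ⟨c, rfl⟩
    exact Submodule.mem_map_of_mem ⟨Fd.trigPoly w s c, rfl⟩
  set e : EuclideanSpace ℂ s := WithLp.toLp 2 fun k : s => mFourier (-(k : Fin d → ℤ)) x with he
  refine ⟨B.adjoint e, ⟨e, rfl⟩, ?_⟩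
  set y : EuclideanSpace ℂ s :=
    WithLp.toLp 2 (fun k : s => ((1 / w k : ℝ) : ℂ) * mFourier (-(k : Fin d → ℤ)) x) -
      B.adjoint e with hy
  -- So `y` is the adjoint of the compressed difference applied to `e`; taking `c = y` bounds its
  -- norm.
  have hinner : ∀ c, inner ℂ y c =
      inner ℂ e (Wiener.finCoeff s ((embFdWiener hw hσ - A) (Fd.trigPoly w s c))) := fun c => by
    rw [hy, inner_sub_left, LinearMap.adjoint_inner_left, sub_apply, map_sub, inner_sub_right]
    refine congrArg₂ _ ?_ rfl
    simp only [PiLp.inner_apply]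
    refine Finset.sum_congr rfl fun k _ => ?_
    rw [Wiener.finCoeff_apply, toL1_embFdWiener, Fd.coeff_trigPoly hw, dif_pos k.2]
    simp only [he, RCLike.inner_apply, map_mul, Complex.conj_ofReal]
    ring
  have hle : ‖y‖ * ‖y‖ ≤ ‖embFdWiener hw hσ - A‖ * ‖y‖ := by
    calc ‖y‖ * ‖y‖ = ‖inner ℂ y y‖ := by
          rw [inner_self_eq_norm_sq_to_K, norm_pow, RCLike.norm_ofReal, abs_norm, sq]
      _ ≤ ‖(embFdWiener hw hσ - A) (Fd.trigPoly w s y)‖ := by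
          rw [hinner]
          exact Wiener.norm_inner_finCoeff_le s _ e fun k => norm_mFourier_apply_le _ x
      _ ≤ ‖embFdWiener hw hσ - A‖ * ‖y‖ := by
          rw [← Fd.norm_trigPoly hw s y]
          exact ContinuousLinearMap.le_opNorm _ _
  rcases (norm_nonneg y).eq_or_lt with h0 | h0
  · rw [← h0]; exact norm_nonneg _
  · exact le_of_mul_le_mul_right hle h0

/-! ### Comparison of the approximation numbers -/

/-- Squaring allows `δ → 0`; the case `a ≤ 0` is separated because squaring needs a sign. -/
theorem le_of_tail_bounds {n : ℕ} {σ : (Fin d → ℤ) → ℝ} {a r : ℝ} (hr : 0 ≤ r)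
    (ha : ∀ t : Finset (Fin d → ℤ), t.card < n → a ≤ √(∑' k : {k // k ∉ t}, σ k ^ 2))
    (h : ∀ δ : ℝ, 0 < δ → ∃ t : Finset (Fin d → ℤ), t.card < n ∧
      ∑' k : {k // k ∉ t}, σ k ^ 2 ≤ r ^ 2 + δ) : a ≤ r := by
  rw [← Real.sqrt_sq hr]
  refine (le_or_gt a 0).elim (fun h0 => h0.trans (Real.sqrt_nonneg _)) fun h0 => ?_
  refine Real.le_sqrt_of_sq_le (le_of_forall_pos_le_add fun δ hδ => ?_)
  obtain ⟨t, ht, htr⟩ := h δ hδ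
  exact ((Real.le_sqrt h0.le (tsum_nonneg fun _ => sq_nonneg _)).1 (ha t ht)).trans htr

/-- The embedding of `ℳ` factors through `ℬ` by a map of norm at most one, so composing with that
map turns competitors for `ℬ` into competitors for `ℳ`. -/
theorem approxNumber_embMSpaceDFd_le (hσ : Summable fun k => (1 / w k) ^ 2) {n : ℕ} (hn : 1 ≤ n) :
    approxNumber n (embMSpaceDFd hσ : MSpace d →L[ℂ] DFd fun k => 1 / w k) ≤
      approxNumber n (embBSpaceDFd hσ) := by
  refine le_approxNumber hn fun A hA => ?_
  refine (approxNumber_le (A := A.comp MSpace.toBSpace)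
    ((LinearMap.rank_comp_le_left _ _).trans_lt hA)).trans ?_
  rw [embMSpaceDFd, ← ContinuousLinearMap.sub_comp]
  exact (ContinuousLinearMap.opNorm_comp_le _ _).trans
    (mul_le_of_le_one_right (norm_nonneg _) MSpace.norm_toBSpace_le)

end Embeddings

end TorusApprox

end

/-! ### Conclusion: the cycle of inequalities -/

theorem mainTheorem10 (d : ℕ) (hd : 1 ≤ d) (w : (Fin d → ℤ) → ℝ) (hw : ∀ k, 0 < w k)
    (hsum : Summable fun k => (w k) ^ (-2 : ℤ)) :
    ∃ (IM : TorusApprox.MSpace d →L[ℂ] TorusApprox.DFd (fun k => 1 / w k))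
      (IB : TorusApprox.BSpace d →L[ℂ] TorusApprox.DFd (fun k => 1 / w k))
      (IA : TorusApprox.Fd w →L[ℂ] TorusApprox.Wiener d),
      (∀ (μ : TorusApprox.MSpace d) (φ : TorusApprox.TestFunctions d),
        ((IM μ).toD : Module.Dual ℂ (TorusApprox.TestFunctions d)) φ =
          VectorMeasure.integral μ.toMeasure (φ : TorusApprox.Torus d → ℂ)
            (ContinuousLinearMap.mul ℝ ℂ)) ∧
      (∀ g : TorusApprox.BSpace d, (IB g).toD = g.toD) ∧
      (∀ f : TorusApprox.Fd w, (IA f).toL1 = f.toL1) ∧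
      ∀ n : ℕ, 1 ≤ n →
        TorusApprox.approxNumber n IM = TorusApprox.approxNumber n IB ∧
        TorusApprox.approxNumber n IB = TorusApprox.approxNumber n IA := by
  have hσ : Summable fun k => (1 / w k) ^ 2 := by
    convert hsum using 2 with k
    rw [one_div, inv_pow, zpow_neg]
    rfl
  refine ⟨TorusApprox.embMSpaceDFd hσ, TorusApprox.embBSpaceDFd hσ,
    TorusApprox.embFdWiener hw hσ, fun _ _ => rfl, fun _ => rfl, fun _ => rfl, fun n hn => ?_⟩
  have hMB := TorusApprox.approxNumber_embMSpaceDFd_le hσ hn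
  -- In this and the next two inequalities, the left number is at most every tail, and each
  -- competitor on the right dominates some tail up to `δ`.
  have hBM : TorusApprox.approxNumber n (TorusApprox.embBSpaceDFd hσ) ≤
      TorusApprox.approxNumber n (TorusApprox.embMSpaceDFd hσ) :=
    TorusApprox.le_approxNumber hn fun A hA => TorusApprox.le_of_tail_bounds (σ := fun k => 1 / w k)
      (norm_nonneg _)
      (TorusApprox.approxNumber_embBSpaceDFd_le hσ)
      fun δ hδ => TorusApprox.exists_tsum_tail_le_embMSpaceDFd hσ hA hδ
  have hBA : TorusApprox.approxNumber n (TorusApprox.embBSpaceDFd hσ) ≤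
      TorusApprox.approxNumber n (TorusApprox.embFdWiener hw hσ) :=
    TorusApprox.le_approxNumber hn fun A hA => TorusApprox.le_of_tail_bounds (σ := fun k => 1 / w k)
      (norm_nonneg _)
      (TorusApprox.approxNumber_embBSpaceDFd_le hσ)
      fun δ hδ => TorusApprox.exists_tsum_tail_le_embFdWiener hw hσ hA hδ
  have hAM : TorusApprox.approxNumber n (TorusApprox.embFdWiener hw hσ) ≤
      TorusApprox.approxNumber n (TorusApprox.embMSpaceDFd hσ) :=
    TorusApprox.le_approxNumber hn fun A hA => TorusApprox.le_of_tail_bounds (σ := fun k => 1 / w k)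
      (norm_nonneg _)
      (TorusApprox.approxNumber_embFdWiener_le hw hσ)
      fun δ hδ => TorusApprox.exists_tsum_tail_le_embMSpaceDFd hσ hA hδ
  exact ⟨le_antisymm hMB hBM, le_antisymm hBA (hAM.trans hMB)⟩
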